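/- All graphs are finite and simple. In a drawing of a graph in the plane, vertices are distinct points, each edge is a simple arc joining its two end vertices and containing no other vertex, and any two edges have only finitely many points in common; two edges cross if they share a point that is not a common end vertex. A drawing is planar if no two edges cross, and quasiplanar if no three edges pairwise cross. Graphs $G_1=(V,E_1),\dots,G_k=(V,E_k)$ with a shared vertex set $V$ admit a QuaSEFE if there are quasiplanar drawings $\Gamma_1,\dots,\Gamma_k$ of $G_1,\dots,G_k$ such that each vertex of $V$ has the same position in every $\Gamma_i$ and each edge shared by two graphs $G_i$ and $G_j$ is represented by the same curve in $\Gamma_i$ and $\Gamma_j$. A planar embedding is a planar drawing up to homeomorphisms of the plane. **Theorem.** Let $G_1=(V,E_1)$, $G_2=(V,E_2)$, $G_3=(V,E_3)$ be planar graphs with shared vertex set $V$, and let $H=(V,E_1\cap E_2\cap E_3)$ be the graph of their common edges. If $H$ has a planar embedding that can be extended to a planar embedding of each graph $G_i$, $i=1,2,3$ (that is, each $G_i$ has a planar drawing whose restriction to $H$ realizes the given embedding of $H$), then $\langle G_1,G_2,G_3\rangle$ admits a QuaSEFE. -/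

import Mathlib

/-- The Euclidean plane. -/
abbrev Plane : Type := EuclideanSpace ℝ (Fin 2)

/-- `A` is a simple (Jordan) arc in the plane with end points `p` and `q`. -/
def IsArcBetween (A : Set Plane) (p q : Plane) : Prop :=
  ∃ γ : unitInterval → Plane,
    Continuous γ ∧ Function.Injective γ ∧ γ 0 = p ∧ γ 1 = q ∧ Set.range γ = A

/-- A (topological) drawing of a graph in the plane: vertices are distinct points, every edge is a
simple arc joining its two end vertices and containing no other vertex, and two distinct edges have
only finitely many points in common. The value of `arc` matters on the edges of `G` only. -/
structure Drawing {V : Type*} (G : SimpleGraph V) where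
  /-- the position of a vertex -/
  pos : V → Plane
  /-- the curve that represents an edge -/
  arc : Sym2 V → Set Plane
  pos_injective : Function.Injective pos
  isArc : ∀ u v : V, G.Adj u v → IsArcBetween (arc s(u, v)) (pos u) (pos v)
  mem_of_pos_mem : ∀ e ∈ G.edgeSet, ∀ w : V, pos w ∈ arc e → w ∈ e
  finite_inter : ∀ e ∈ G.edgeSet, ∀ f ∈ G.edgeSet, e ≠ f → (arc e ∩ arc f).Finite

namespace Drawing

variable {V : Type*} {G H : SimpleGraph V}

/-- Two distinct edges cross if their curves share a point that is not a vertex. (As edges avoid all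
vertices but their own ends, this is a point other than a common end point. A point where two curves
merely touch counts as a crossing, too.) -/
def Cross (Γ : Drawing G) (e f : Sym2 V) : Prop :=
  e ≠ f ∧ ∃ p ∈ Γ.arc e ∩ Γ.arc f, p ∉ Set.range Γ.pos

/-- A drawing is planar if no two edges cross. -/
def IsPlanar (Γ : Drawing G) : Prop :=
  ∀ e ∈ G.edgeSet, ∀ f ∈ G.edgeSet, ¬ Γ.Cross e f

/-- A drawing is quasiplanar if no three edges pairwise cross. -/
def IsQuasiplanar (Γ : Drawing G) : Prop :=
  ∀ e ∈ G.edgeSet, ∀ f ∈ G.edgeSet, ∀ g ∈ G.edgeSet,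
    ¬ (Γ.Cross e f ∧ Γ.Cross f g ∧ Γ.Cross e g)

/-- The restriction of a drawing to a subgraph on the same vertex set. -/
def restrict (Γ : Drawing G) (h : H ≤ G) : Drawing H where
  pos := Γ.pos
  arc := Γ.arc
  pos_injective := Γ.pos_injective
  isArc u v huv := Γ.isArc u v (h huv)
  mem_of_pos_mem e he := Γ.mem_of_pos_mem e (SimpleGraph.edgeSet_mono h he)
  finite_inter e he f hf :=
    Γ.finite_inter e (SimpleGraph.edgeSet_mono h he) f (SimpleGraph.edgeSet_mono h hf)

/-- Two drawings are equivalent if a homeomorphism of the plane carries one to the other, vertex by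
vertex and edge by edge. An embedding is an equivalence class of planar drawings. -/
def Equivalent (Γ Δ : Drawing G) : Prop :=
  ∃ φ : Plane ≃ₜ Plane,
    (∀ v : V, φ (Γ.pos v) = Δ.pos v) ∧ ∀ e ∈ G.edgeSet, φ '' Γ.arc e = Δ.arc e

/-- The planar embedding given by the drawing `Δ` of `H` extends to a planar embedding of the
supergraph `G`: some planar drawing of `G` restricts to a drawing of `H` equivalent to `Δ`. -/
def ExtendsTo (Δ : Drawing H) (h : H ≤ G) : Prop :=
  ∃ Γ : Drawing G, Γ.IsPlanar ∧ (Γ.restrict h).Equivalent Δ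

end Drawing

/-- A graph is planar if it has a planar drawing. -/
def IsPlanarGraph {V : Type*} (G : SimpleGraph V) : Prop :=
  ∃ Γ : Drawing G, Γ.IsPlanar

/-- The graphs `G i`, on a shared vertex set, admit a QuaSEFE (quasiplanar simultaneous embedding
with fixed edges): they have quasiplanar drawings in which every vertex has the same position in all
drawings, and every edge shared by two graphs is represented by the same curve in both. -/
def AdmitsQuaSEFE {V ι : Type*} (G : ι → SimpleGraph V) : Prop :=
  ∃ Γ : ∀ i, Drawing (G i),
    (∀ i, (Γ i).IsQuasiplanar) ∧
    (∀ i j, ∀ v : V, (Γ i).pos v = (Γ j).pos v) ∧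
    ∀ i j, ∀ e ∈ (G i).edgeSet ∩ (G j).edgeSet, (Γ i).arc e = (Γ j).arc e

open Set Filter Topology

/-! Homeomorphisms of the plane turn the three extensions into planar drawings `B 0`, `B 1`, `B 2`
with the same vertex positions and the same curves for the edges of `H`. Each edge now takes its
curve from one of them: an edge of all three graphs has the same curve in each, an edge of a single
graph keeps its curve there, and an edge of exactly two graphs, with indices `i` and `i + 1` modulo
3, is drawn as in `B i`. So the edges of `G i` use curves of `B i` and `B (i - 1)` only. Of any
three edges, two come from the same planar drawing and do not cross
(`admitsQuaSEFE_of_common_drawing`).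

Curves from different drawings may meet infinitely often, which a drawing forbids;
`exists_redrawing` repairs this. Away from small discs around the vertices, arcs that must not cross
have positive distance, so close polygonal approximations stay disjoint. Inside the discs, straight
segments run to the vertex, and two of them with well separated directions meet only there. Polygon
corners off the lines through all earlier segments make the intersections finite
(`exists_polygonal_arc`, `exists_pairwise_finite_inter`). -/

/-! ### Arcs: reparametrization, concatenation, trimming -/

theorem isArcBetween_image_Icc {γ : ℝ → Plane} {a b : ℝ} (hab : a < b)
    (hc : ContinuousOn γ (Icc a b)) (hi : InjOn γ (Icc a b)) :
    IsArcBetween (γ '' Icc a b) (γ a) (γ b) := by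
  refine ⟨fun t => γ ((iccHomeoI a b hab).symm t), ?_, ?_, ?_, ?_, ?_⟩
  · exact hc.domRestrict.comp (iccHomeoI a b hab).symm.continuous
  · intro x y hxy
    exact (iccHomeoI a b hab).symm.injective
      (Subtype.ext (hi (Subtype.prop _) (Subtype.prop _) hxy))
  · simp
  · simp
  · ext p
    constructor
    · rintro ⟨t, rfl⟩
      exact ⟨_, Subtype.prop _, rfl⟩
    · rintro ⟨x, hx, rfl⟩
      exact ⟨iccHomeoI a b hab ⟨x, hx⟩, by simp⟩

theorem IsArcBetween.exists_real_param {A : Set Plane} {p q : Plane} (h : IsArcBetween A p q) :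
    ∃ γ : ℝ → Plane, Continuous γ ∧ InjOn γ (Icc 0 1) ∧ γ 0 = p ∧ γ 1 = q ∧
      γ '' Icc 0 1 = A := by
  obtain ⟨γ, hc, hi, h0, h1, rfl⟩ := h
  have key : ∀ x (hx : x ∈ Icc (0 : ℝ) 1), IccExtend zero_le_one γ x = γ ⟨x, hx⟩ :=
    fun x hx => IccExtend_of_mem _ _ hx
  refine ⟨IccExtend zero_le_one γ, hc.Icc_extend', ?_, ?_, ?_, ?_⟩
  · intro x hx y hy hxy
    rw [key x hx, key y hy] at hxy
    exact congrArg Subtype.val (hi hxy)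
  · rw [key 0 (by simp)]; exact h0
  · rw [key 1 (by simp)]; exact h1
  · ext p
    constructor
    · rintro ⟨x, hx, rfl⟩
      exact ⟨_, (key x hx).symm⟩
    · rintro ⟨t, rfl⟩
      exact ⟨t, t.2, key t t.2⟩

theorem IsArcBetween.symm {A : Set Plane} {p q : Plane} (h : IsArcBetween A p q) :
    IsArcBetween A q p := by
  obtain ⟨γ, hc, hi, h0, h1, rfl⟩ := h
  refine ⟨fun t => γ (unitInterval.symm t), by fun_prop,
    hi.comp unitInterval.symm_bijective.injective, by simpa, by simpa, ?_⟩
  exact unitInterval.symm_bijective.surjective.range_comp γ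

theorem IsArcBetween.image {A : Set Plane} {p q : Plane} (h : IsArcBetween A p q)
    (φ : Plane ≃ₜ Plane) : IsArcBetween (φ '' A) (φ p) (φ q) := by
  obtain ⟨γ, hc, hi, rfl, rfl, rfl⟩ := h
  exact ⟨φ ∘ γ, φ.continuous.comp hc, φ.injective.comp hi, rfl, rfl, range_comp φ γ⟩

/-- A simple curve can be prolonged by a segment that meets it in its last point only. -/
theorem isArcBetween_image_union_segment {γ : ℝ → Plane} {a b : ℝ} {z : Plane} (hab : a ≤ b)
    (hc : Continuous γ) (hi : InjOn γ (Icc a b)) (hz : γ b ≠ z)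
    (hd : ∀ t ∈ Icc a b, γ t ∈ segment ℝ (γ b) z → t = b) :
    IsArcBetween (γ '' Icc a b ∪ segment ℝ (γ b) z) (γ a) z := by
  set l : ℝ → Plane := fun t => AffineMap.lineMap (γ b) z (t - b) with hl
  set f : ℝ → Plane := fun t => if t ≤ b then γ t else l t with hf
  have hlc : Continuous l := by
    rw [hl]; exact AffineMap.lineMap_continuous.comp (continuous_id.sub continuous_const)
  have hlb : l b = γ b := by simp [hl]
  have hfc : Continuous f := hc.if_le hlc continuous_id continuous_const
    (fun t ht => by rw [ht, hlb])
  have f1 : ∀ t, t ≤ b → f t = γ t := fun t ht => by simp [hf, ht]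
  have f2 : ∀ t, b ≤ t → f t = l t := by
    intro t ht
    rcases ht.eq_or_lt with rfl | h
    · rw [f1 _ le_rfl, hlb]
    · simp [hf, not_le.2 h]
  have hls : ∀ t ∈ Icc b (b + 1), l t ∈ segment ℝ (γ b) z := by
    intro t ht
    rw [segment_eq_image_lineMap]
    exact ⟨t - b, ⟨by linarith [ht.1], by linarith [ht.2]⟩, rfl⟩
  have hli : Function.Injective l := by
    intro x y hxy
    have := AffineMap.lineMap_injective ℝ hz hxy
    linarith
  have himg : f '' Icc a (b + 1) = γ '' Icc a b ∪ segment ℝ (γ b) z := by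
    ext p
    constructor
    · rintro ⟨t, ht, rfl⟩
      rcases le_total t b with h | h
      · exact Or.inl ⟨t, ⟨ht.1, h⟩, (f1 t h).symm⟩
      · right; rw [f2 t h]; exact hls t ⟨h, ht.2⟩
    · rintro (⟨t, ht, rfl⟩ | hp)
      · exact ⟨t, ⟨ht.1, by linarith [ht.2]⟩, f1 t ht.2⟩
      · rw [segment_eq_image_lineMap] at hp
        obtain ⟨s, hs, rfl⟩ := hp
        refine ⟨b + s, ⟨by linarith [hs.1], by linarith [hs.2]⟩, ?_⟩
        rw [f2 _ (by linarith [hs.1])]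
        simp [hl]
  have hmix : ∀ x ∈ Icc a b, ∀ y ∈ Icc b (b + 1), f x = f y → x = y := by
    intro x hx y hy hxy
    rw [f1 x hx.2, f2 y hy.1] at hxy
    have hxb : x = b := hd x hx (hxy ▸ hls y hy)
    subst hxb
    exact hli (hlb.trans hxy)
  have hinj : InjOn f (Icc a (b + 1)) := by
    intro x hx y hy hxy
    rcases le_total x b with h1 | h1 <;> rcases le_total y b with h2 | h2
    · rw [f1 x h1, f1 y h2] at hxy
      exact hi ⟨hx.1, h1⟩ ⟨hy.1, h2⟩ hxy
    · exact hmix x ⟨hx.1, h1⟩ y ⟨h2, hy.2⟩ hxy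
    · exact (hmix y ⟨hy.1, h2⟩ x ⟨h1, hx.2⟩ hxy.symm).symm
    · rw [f2 x h1, f2 y h2] at hxy
      exact hli hxy
  have := isArcBetween_image_Icc (by linarith) hfc.continuousOn hinj
  rw [himg, f1 a hab, f2 (b + 1) (by linarith)] at this
  simpa [hl] using this

/-- Follow the arc until it first hits the segment, then follow the segment to `z`. -/
theorem IsArcBetween.exists_subset_union_segment {A : Set Plane} {x y z : Plane}
    (hA : IsArcBetween A x y) (hxz : x ≠ z) :
    ∃ C ⊆ A ∪ segment ℝ y z, IsArcBetween C x z := by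
  obtain ⟨γ, hc, hi, rfl, rfl, rfl⟩ := hA.exists_real_param
  have hcl : IsClosed (segment ℝ (γ 1) z) := by
    rw [segment_eq_image_lineMap]
    exact (isCompact_Icc.image AffineMap.lineMap_continuous).isClosed
  have hS : IsCompact (Icc (0 : ℝ) 1 ∩ γ ⁻¹' segment ℝ (γ 1) z) :=
    isCompact_Icc.inter_right (hcl.preimage hc)
  obtain ⟨t, ⟨ht, htS⟩, hmin⟩ :=
    hS.exists_isLeast ⟨1, by simp, left_mem_segment ℝ (γ 1) z⟩
  have hsub : Icc 0 t ⊆ Icc (0 : ℝ) 1 := Icc_subset_Icc le_rfl ht.2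
  have hseg : segment ℝ (γ t) z ⊆ segment ℝ (γ 1) z :=
    (convex_segment _ _).segment_subset htS (right_mem_segment ℝ _ _)
  -- If the first hit is `z`, the initial piece already ends there and no segment is appended.
  by_cases htz : γ t = z
  · have ht0 : 0 < t := ht.1.lt_of_ne (by rintro rfl; exact hxz htz)
    refine ⟨γ '' Icc 0 t, subset_union_of_subset_left (image_mono hsub) _, ?_⟩
    have := isArcBetween_image_Icc ht0 hc.continuousOn (hi.mono hsub)
    rwa [htz] at this
  · refine ⟨_, union_subset_union (image_mono hsub) hseg,
      isArcBetween_image_union_segment ht.1 hc (hi.mono hsub) htz ?_⟩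
    intro s hs hsz
    exact le_antisymm hs.2 (hmin ⟨hsub hs, hseg hsz⟩)

/-- A polygonal path with distinct ends contains an arc between its ends. -/
theorem exists_arc_subset_polygon (q : ℕ → Plane) (n : ℕ) (h : q 0 ≠ q n) :
    ∃ C ⊆ ⋃ i < n, segment ℝ (q i) (q (i + 1)), IsArcBetween C (q 0) (q n) := by
  induction n with
  | zero => exact absurd rfl h
  | succ n ih =>
    have hmono : (⋃ i < n, segment ℝ (q i) (q (i + 1))) ∪ segment ℝ (q n) (q (n + 1)) ⊆
        ⋃ i < n + 1, segment ℝ (q i) (q (i + 1)) := by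
      refine union_subset (iUnion₂_subset fun i hi => ?_) ?_
      · exact subset_biUnion_of_mem (u := fun i => segment ℝ (q i) (q (i + 1)))
          (show i < n + 1 by omega)
      · exact subset_biUnion_of_mem (u := fun i => segment ℝ (q i) (q (i + 1)))
          (show n < n + 1 by omega)
    -- If the path is back at its start, its last segment alone is the arc.
    by_cases h0 : q 0 = q n
    · refine ⟨segment ℝ (q n) (q (n + 1)), subset_union_right.trans hmono, ?_⟩
      rw [h0] at h ⊢
      have := isArcBetween_image_Icc (zero_lt_one (α := ℝ))
        (AffineMap.lineMap_continuous (p := q n) (q := q (n + 1))).continuousOn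
        (AffineMap.lineMap_injective ℝ h).injOn
      rw [segment_eq_image_lineMap]
      simpa using this
    · obtain ⟨C, hC, hCa⟩ := ih h0
      obtain ⟨D, hD, hDa⟩ := hCa.exists_subset_union_segment h
      exact ⟨D, (hD.trans (union_subset_union_left _ hC)).trans hmono, hDa⟩

/-- An arc contains a curve between the spheres of radius `r` around its ends that avoids the
open balls bounded by these spheres. -/
theorem IsArcBetween.exists_curve_between_spheres {A : Set Plane} {p q : Plane}
    (hA : IsArcBetween A p q) {r : ℝ} (hr : 0 < r) (hpq : 2 * r < dist p q) :
    ∃ (γ : ℝ → Plane) (s t : ℝ), Continuous γ ∧ s ≤ t ∧ γ '' Icc s t ⊆ A ∧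
      dist (γ s) p = r ∧ dist (γ t) q = r ∧
      ∀ x ∈ γ '' Icc s t, r ≤ dist x p ∧ r ≤ dist x q := by
  obtain ⟨γ, hc, hi, rfl, rfl, rfl⟩ := hA.exists_real_param
  have hcd : ∀ c, Continuous fun t => dist (γ t) c := fun c => by fun_prop
  -- `t` is the first time within `r` of `q`; below, `s` is the last time before `t` within `r` of
  -- `p`. An excursion into an open ball would, by the intermediate value theorem, contradict
  -- extremality.
  have hS : IsCompact (Icc (0 : ℝ) 1 ∩ {t | dist (γ t) (γ 1) ≤ r}) :=
    isCompact_Icc.inter_right (isClosed_le (hcd _) continuous_const)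
  obtain ⟨t, ⟨ht, htS⟩, hmin⟩ := hS.exists_isLeast ⟨1, by simp, by simp [hr.le]⟩
  have hbefore : ∀ τ ∈ Icc 0 t, r ≤ dist (γ τ) (γ 1) := by
    intro τ hτ
    by_contra! hlt
    obtain ⟨σ, hσ, hσr⟩ := intermediate_value_Icc' hτ.1 (hcd (γ 1)).continuousOn
      (show r ∈ Icc _ _ from ⟨hlt.le, by linarith⟩)
    have h1 : t ≤ σ := hmin ⟨⟨hσ.1, by linarith [hσ.2, hτ.2, ht.2]⟩, hσr.le⟩
    have : σ = τ := le_antisymm hσ.2 (hτ.2.trans h1)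
    subst this
    exact hlt.ne hσr
  have htr : dist (γ t) (γ 1) = r := le_antisymm htS (hbefore t ⟨ht.1, le_rfl⟩)
  have htp : r < dist (γ t) (γ 0) := by
    have := dist_triangle (γ 0) (γ t) (γ 1)
    rw [dist_comm (γ 0) (γ t)] at this
    linarith
  have hT : IsCompact (Icc 0 t ∩ {s | dist (γ s) (γ 0) ≤ r}) :=
    isCompact_Icc.inter_right (isClosed_le (hcd _) continuous_const)
  obtain ⟨s, ⟨hs, hsT⟩, hmax⟩ :=
    hT.exists_isGreatest ⟨0, ⟨le_rfl, ht.1⟩, by simp [hr.le]⟩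
  have hafter : ∀ τ ∈ Icc s t, r ≤ dist (γ τ) (γ 0) := by
    intro τ hτ
    by_contra! hlt
    obtain ⟨σ, hσ, hσr⟩ := intermediate_value_Icc hτ.2 (hcd (γ 0)).continuousOn
      (show r ∈ Icc _ _ from ⟨hlt.le, htp.le⟩)
    have h1 : σ ≤ s := hmax ⟨⟨by linarith [hσ.1, hτ.1, hs.1], hσ.2⟩, hσr.le⟩
    have : σ = τ := le_antisymm (h1.trans hτ.1) hσ.1
    subst this
    exact hlt.ne hσr
  refine ⟨γ, s, t, hc, hs.2, image_mono (Icc_subset_Icc hs.1 ht.2),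
    le_antisymm hsT (hafter s ⟨le_rfl, hs.2⟩), htr, ?_⟩
  rintro _ ⟨τ, hτ, rfl⟩
  exact ⟨hafter τ hτ, hbefore τ ⟨hs.1.trans hτ.1, hτ.2⟩⟩

/-! ### Polygons in general position -/

theorem interior_line_eq_empty (c d : Plane) : interior (line[ℝ, c, d] : Set Plane) = ∅ := by
  by_contra hne
  have htop : line[ℝ, c, d] = ⊤ := top_unique
    (isOpen_interior.affineSpan_eq_top (nonempty_iff_ne_empty.2 hne) ▸
      affineSpan_le.2 interior_subset)
  have h1 : Collinear ℝ ({c, d} : Set Plane) := collinear_pair ℝ c d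
  have h2 : Module.finrank ℝ (vectorSpan ℝ ({c, d} : Set Plane)) ≤ 1 := h1.finrank_le_one
  rw [← direction_affineSpan, htop, AffineSubspace.direction_top, finrank_top,
    finrank_euclideanSpace_fin] at h2
  omega

/-- Finitely many lines do not cover a ball. -/
theorem exists_mem_ball_notMem_lines (L : Finset (Plane × Plane)) (x : Plane) {η : ℝ}
    (hη : 0 < η) : ∃ y ∈ Metric.ball x η, ∀ l ∈ L, y ∉ line[ℝ, l.1, l.2] := by
  have hd : Dense (⋂ l ∈ L, (line[ℝ, l.1, l.2] : Set Plane)ᶜ) := by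
    refine dense_biInter_of_isOpen (fun l _ => ?_) L.countable_toSet (fun l _ => ?_)
    · exact (AffineSubspace.closed_of_finiteDimensional _).isOpen_compl
    · exact interior_eq_empty_iff_dense_compl.1 (interior_line_eq_empty _ _)
  obtain ⟨y, hy, hyb⟩ := hd.exists_mem_open Metric.isOpen_ball ⟨x, Metric.mem_ball_self hη⟩
  exact ⟨y, hyb, fun l hl => mem_iInter₂.1 hy l hl⟩

theorem segment_subset_line (c d : Plane) : segment ℝ c d ⊆ line[ℝ, c, d] := by
  rw [segment_eq_image_lineMap]
  rintro _ ⟨t, -, rfl⟩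
  exact AffineMap.lineMap_mem_affineSpan_pair t c d

theorem finite_segment_inter_segment {a b c d : Plane} (h : a ∉ line[ℝ, c, d]) :
    (segment ℝ a b ∩ segment ℝ c d).Finite := by
  refine Set.Subsingleton.finite ?_
  rintro p ⟨hp, hp'⟩ q ⟨hq, hq'⟩
  by_contra hpq
  apply h
  rw [segment_eq_image_lineMap] at hp hq
  obtain ⟨s, -, rfl⟩ := hp
  obtain ⟨t, -, rfl⟩ := hq
  have hst : s - t ≠ 0 := fun h0 => hpq (by rw [sub_eq_zero.1 h0])
  -- Two common points would span a line through `a`; this parameter recovers `a` from them.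
  have key := AffineMap.lineMap_mem (s / (s - t))
    (segment_subset_line c d hp') (segment_subset_line c d hq')
  convert key using 1
  simp only [AffineMap.lineMap_apply_module]
  match_scalars <;> field_simp <;> ring

/-- A curve can be approximated by a polygon with vertices off finitely many lines. -/
theorem exists_polygon_near_curve (L : Finset (Plane × Plane)) {γ : ℝ → Plane} {s t : ℝ}
    (hc : Continuous γ) (hst : s ≤ t) {η : ℝ} (hη : 0 < η) :
    ∃ (n : ℕ) (m : ℕ → Plane), (∀ i, ∀ l ∈ L, m i ∉ line[ℝ, l.1, l.2]) ∧
      m 0 ∈ Metric.ball (γ s) η ∧ m n ∈ Metric.ball (γ t) η ∧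
      ∀ i < n, segment ℝ (m i) (m (i + 1)) ⊆ Metric.thickening (2 * η) (γ '' Icc s t) := by
  obtain ⟨δ, hδ, hu⟩ := Metric.uniformContinuousOn_iff.1
    (isCompact_Icc.uniformContinuousOn_of_continuous (hc.continuousOn (s := Icc s t))) η hη
  obtain ⟨n, hn⟩ := exists_nat_gt ((t - s) / δ)
  have hn0 : (0 : ℝ) < n := (div_nonneg (by linarith) hδ.le).trans_lt hn
  set τ : ℕ → ℝ := fun i => s + (t - s) * (i / n) with hτ
  have hτm : ∀ i ≤ n, τ i ∈ Icc s t := by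
    intro i hi
    have h1 : (i : ℝ) / n ≤ 1 := (div_le_one hn0).2 (by exact_mod_cast hi)
    have h0 : 0 ≤ (i : ℝ) / n := by positivity
    constructor <;> simp only [hτ] <;> nlinarith
  choose m hm hmL using fun i => exists_mem_ball_notMem_lines L (γ (τ i)) hη
  refine ⟨n, m, hmL, ?_, ?_, ?_⟩
  · simpa [hτ] using hm 0
  · have : τ n = t := by simp [hτ, hn0.ne']
    simpa [this] using hm n
  · intro i hi
    have hd : dist (τ (i + 1)) (τ i) < δ := by
      have : τ (i + 1) - τ i = (t - s) / n := by simp only [hτ]; push_cast; field_simp; ring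
      rw [Real.dist_eq, this, abs_of_nonneg (div_nonneg (by linarith) hn0.le), div_lt_iff₀ hn0]
      rwa [div_lt_iff₀ hδ, mul_comm] at hn
    have hd' := hu _ (hτm (i + 1) hi) _ (hτm i hi.le) hd
    -- One `η` pays for the perturbation of the corner, the other for the step from `τ i` to `τ (i +
    -- 1)`.
    have hsub : segment ℝ (m i) (m (i + 1)) ⊆ Metric.ball (γ (τ i)) (2 * η) := by
      refine (convex_ball _ _).segment_subset ?_ ?_
      · exact Metric.ball_subset_ball (by linarith) (hm i)
      · have h1 := Metric.mem_ball.1 (hm (i + 1))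
        rw [Metric.mem_ball]
        linarith [dist_triangle (m (i + 1)) (γ (τ (i + 1))) (γ (τ i))]
    exact hsub.trans (Metric.ball_subset_thickening (mem_image_of_mem γ (hτm i hi.le)) _)

/-! ### Polygonal arcs and cones at the vertices -/

/-- The union of the segments from `p` to the points of the ball of radius `η` around `y`. -/
def segmentCone (p y : Plane) (η : ℝ) : Set Plane :=
  ⋃ y' ∈ Metric.ball y η, segment ℝ p y'

/-- A curve whose ends are joined to `p` and `q` by segments can be replaced by a nearby polygonal
arc that meets each of finitely many given segments finitely often. -/
theorem exists_polygonal_arc (L : Finset (Plane × Plane)) {γ : ℝ → Plane} {s t : ℝ}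
    (hc : Continuous γ) (hst : s ≤ t) {η : ℝ} (hη : 0 < η) {p q : Plane} (hpq : p ≠ q) :
    ∃ (C : Set Plane) (S : Finset (Plane × Plane)), IsArcBetween C p q ∧
      (C ⊆ ⋃ x ∈ S, segment ℝ x.1 x.2) ∧
      (∀ x ∈ S, ∀ l ∈ L, (segment ℝ x.1 x.2 ∩ segment ℝ l.1 l.2).Finite) ∧
      C ⊆ segmentCone p (γ s) η ∪ segmentCone q (γ t) η ∪
        Metric.thickening (2 * η) (γ '' Icc s t) := by
  classical
  obtain ⟨n, m, hmL, hm0, hmn, hseg⟩ := exists_polygon_near_curve L hc hst hη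
  -- The path is `p, m 0, …, m n, q`. The ends `p` and `q` may lie on the given lines, but every
  -- segment has some `m i` as an end, which suffices for finiteness.
  set w : ℕ → Plane := fun i => if i = 0 then p else if i = n + 2 then q else m (i - 1) with hw
  have w0 : w 0 = p := rfl
  have wl : w (n + 2) = q := by simp [hw]
  have wm : ∀ i ≤ n, w (i + 1) = m i := by
    intro i hi
    simp [hw, show i ≠ n + 1 by omega]
  obtain ⟨C, hC, hCa⟩ := exists_arc_subset_polygon w (n + 2) (by rwa [w0, wl])
  rw [w0, wl] at hCa
  refine ⟨C, (Finset.range (n + 2)).image fun i => (w i, w (i + 1)), hCa, ?_, ?_, ?_⟩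
  · refine hC.trans (iUnion₂_subset fun i hi => ?_)
    exact subset_biUnion_of_mem (u := fun x : Plane × Plane => segment ℝ x.1 x.2)
      (Finset.mem_coe.2 (Finset.mem_image_of_mem (fun i => (w i, w (i + 1)))
        (Finset.mem_range.2 hi)))
  · intro x hx l hl
    obtain ⟨i, hi, rfl⟩ := Finset.mem_image.1 hx
    rw [Finset.mem_range] at hi
    rcases Nat.lt_or_ge i (n + 1) with h | h
    · rw [segment_symm]
      apply finite_segment_inter_segment
      rw [wm i (by omega)]
      exact hmL i l hl
    · obtain rfl : i = n + 1 := by omega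
      apply finite_segment_inter_segment
      rw [wm n le_rfl]
      exact hmL n l hl
  · refine hC.trans (iUnion₂_subset fun i hi => ?_)
    rcases Nat.eq_zero_or_pos i with rfl | h0
    · rw [w0, wm 0 (Nat.zero_le _)]
      exact fun x hx => Or.inl (Or.inl (mem_biUnion hm0 hx))
    · obtain ⟨j, rfl⟩ : ∃ j, i = j + 1 := ⟨i - 1, by omega⟩
      rcases Nat.lt_or_ge j n with h | h
      · rw [wm j h.le, wm (j + 1) h]
        exact fun x hx => Or.inr (hseg j h hx)
      · obtain rfl : j = n := by omega
        rw [wm j le_rfl, wl, segment_symm]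
        exact fun x hx => Or.inl (Or.inr (mem_biUnion hmn hx))

/-- The cones over small balls around two points of the circle of radius `r` around `p` that are
far from each other meet in `p` only. -/
theorem eq_of_mem_segmentCone {p y y' z : Plane} {r η : ℝ} (hy : dist y p = r)
    (hy' : dist y' p = r) (h : 4 * η ≤ dist y y') (hz : z ∈ segmentCone p y η)
    (hz' : z ∈ segmentCone p y' η) : z = p := by
  obtain ⟨a, ha, hza⟩ := mem_iUnion₂.1 hz
  obtain ⟨b, hb, hzb⟩ := mem_iUnion₂.1 hz'
  by_contra hne
  have hne' : z - p ≠ 0 := sub_ne_zero.2 hne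
  have hray : ∀ c, z ∈ segment ℝ p c → SameRay ℝ (z - p) (c - p) := by
    intro c hc
    rw [segment_eq_image_lineMap] at hc
    obtain ⟨t, ht, rfl⟩ := hc
    rw [AffineMap.lineMap_apply_module', add_sub_cancel_right]
    exact SameRay.sameRay_nonneg_smul_left _ ht.1
  have hab : SameRay ℝ (a - p) (b - p) :=
    (hray a hza).symm.trans (hray b hzb) (fun h0 => absurd h0 hne')
  -- As `a` and `b` lie on a common ray from `p`, their distance is the difference of their radii.
  have h1 := hab.norm_sub
  rw [sub_sub_sub_cancel_right, ← dist_eq_norm, ← dist_eq_norm, ← dist_eq_norm] at h1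
  rw [Metric.mem_ball] at ha hb
  have h2 : |dist a p - dist b p| < 2 * η := by
    have e1 := dist_triangle a y p
    have e2 := dist_triangle y a p
    have e3 := dist_triangle b y' p
    have e4 := dist_triangle y' b p
    rw [dist_comm y a] at e2
    rw [dist_comm y' b] at e4
    rw [abs_lt]
    constructor <;> linarith
  have h3 := dist_triangle4 y a b y'
  rw [dist_comm y a] at h3
  linarith

theorem dist_lt_of_mem_segmentCone {p y z : Plane} {r η : ℝ} (hy : dist y p = r)
    (hz : z ∈ segmentCone p y η) : dist z p < r + η := by
  obtain ⟨a, ha, hza⟩ := mem_iUnion₂.1 hz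
  rw [Metric.mem_ball] at ha
  have h1 := dist_add_dist_of_mem_segment hza
  rw [dist_comm p z, dist_comm p a] at h1
  linarith [dist_triangle a y p, dist_nonneg (x := z) (y := a)]

/-- Points of the cone that are far from its apex are close to its base. -/
theorem dist_lt_of_mem_segmentCone_of_lt {p y z : Plane} {r η ε : ℝ} (hy : dist y p = r)
    (hz : z ∈ segmentCone p y η) (h : r - ε ≤ dist z p) : dist z y < ε + 2 * η := by
  obtain ⟨a, ha, hza⟩ := mem_iUnion₂.1 hz
  rw [Metric.mem_ball] at ha
  have h1 := dist_add_dist_of_mem_segment hza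
  rw [dist_comm p z, dist_comm p a] at h1
  linarith [dist_triangle a y p, dist_triangle z a y]

/-! ### Uniform separation and pairwise finite intersections -/

/-- Disjoint compact sets of a finite family are uniformly far from each other. -/
theorem exists_pos_forall_le_dist {ι : Type*} [Finite ι] {M : ι → Set Plane}
    (hM : ∀ i, IsCompact (M i)) :
    ∃ δ > 0, ∀ i j, Disjoint (M i) (M j) → ∀ x ∈ M i, ∀ y ∈ M j, δ ≤ dist x y := by
  have h : ∀ᶠ δ in 𝓝[>] (0 : ℝ), ∀ i j, Disjoint (M i) (M j) →
      ∀ x ∈ M i, ∀ y ∈ M j, δ ≤ dist x y := by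
    refine eventually_all.2 fun i => eventually_all.2 fun j => ?_
    by_cases hd : Disjoint (M i) (M j)
    · obtain ⟨ε, hε, hlt⟩ := Metric.exists_pos_forall_lt_edist (hM i) (hM j).isClosed hd
      filter_upwards [Ioo_mem_nhdsGT (NNReal.coe_pos.2 hε)] with δ hδ _ x hx y hy
      have h1 := hlt x hx y hy
      rw [edist_nndist, ENNReal.coe_lt_coe, ← NNReal.coe_lt_coe, coe_nndist] at h1
      exact (hδ.2.trans h1).le
    · exact Eventually.of_forall fun δ h' => absurd h' hd
  obtain ⟨δ, hδ, hpos⟩ := (h.and self_mem_nhdsWithin).exists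
  exact ⟨δ, hpos, hδ⟩

/-- There is a radius such that the balls around the vertices of a drawing are far apart and meet
only the edges at their centres. -/
theorem exists_pos_vertex_radius {V : Type*} [Finite V] {E : Set (Sym2 V)} {pos : V → Plane}
    (hpos : Function.Injective pos) {A : Sym2 V → Set Plane} (hA : ∀ e ∈ E, IsCompact (A e))
    (hmem : ∀ e ∈ E, ∀ w, pos w ∈ A e → w ∈ e) :
    ∃ r > 0, (∀ u w, u ≠ w → 4 * r ≤ dist (pos u) (pos w)) ∧
      ∀ e ∈ E, ∀ w ∉ e, ∀ x ∈ A e, r ≤ dist x (pos w) := by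
  let M : V ⊕ E → Set Plane := Sum.elim (fun v => {pos v}) fun e => A e
  obtain ⟨δ, hδ, h⟩ := exists_pos_forall_le_dist (M := M) (by
    rintro (v | e)
    · exact isCompact_singleton
    · exact hA e e.2)
  refine ⟨δ / 4, by positivity, fun u w huw => ?_, fun e he w hw x hx => ?_⟩
  · have := h (.inl u) (.inl w) (disjoint_singleton.2 (hpos.ne huw)) _ rfl _ rfl
    linarith
  · have := h (.inr ⟨e, he⟩) (.inl w)
      (disjoint_singleton_right.2 fun h' => hw (hmem e he w h')) x hx _ rfl
    linarith

theorem IsArcBetween.isCompact {A : Set Plane} {p q : Plane} (h : IsArcBetween A p q) :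
    IsCompact A := by
  obtain ⟨γ, hc, -, -, -, rfl⟩ := h
  exact isCompact_range hc

/-- If each member of a finite family can be chosen so as to be in finite intersection with
finitely many segments, then the members can be chosen in pairwise finite intersection. -/
theorem exists_pairwise_finite_inter {ι : Type*} [Finite ι] {P : ι → Set Plane → Prop}
    (h : ∀ i, ∀ L : Finset (Plane × Plane), ∃ (C : Set Plane) (S : Finset (Plane × Plane)),
      P i C ∧ (C ⊆ ⋃ x ∈ S, segment ℝ x.1 x.2) ∧
      ∀ x ∈ S, ∀ l ∈ L, (segment ℝ x.1 x.2 ∩ segment ℝ l.1 l.2).Finite) :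
    ∃ C : ι → Set Plane, (∀ i, P i (C i)) ∧ ∀ i j, i ≠ j → (C i ∩ C j).Finite := by
  classical
  have := Fintype.ofFinite ι
  have key : ∀ s : Finset ι, ∃ (C : ι → Set Plane) (S : ι → Finset (Plane × Plane)),
      (∀ i ∈ s, P i (C i) ∧ (C i ⊆ ⋃ x ∈ S i, segment ℝ x.1 x.2)) ∧
      ∀ i ∈ s, ∀ j ∈ s, i ≠ j → (C i ∩ C j).Finite := by
    intro s
    induction s using Finset.induction_on with
    | empty => exact ⟨fun _ => ∅, fun _ => ∅, by simp, by simp⟩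
    | insert k s hk ih =>
      obtain ⟨C, S, h1, h2⟩ := ih
      -- The new member is chosen against all segments covering the earlier ones.
      obtain ⟨D, T, hP, hDT, hfin⟩ := h k (s.biUnion S)
      have hD : ∀ i ∈ s, (D ∩ C i).Finite := by
        intro i hi
        refine ((T.finite_toSet.biUnion fun x hx => (S i).finite_toSet.biUnion fun l hl =>
          hfin x hx l (Finset.mem_biUnion.2 ⟨i, hi, hl⟩))).subset ?_
        rintro z ⟨hzD, hzC⟩
        obtain ⟨x, hx, hzx⟩ := mem_iUnion₂.1 (hDT hzD)
        obtain ⟨l, hl, hzl⟩ := mem_iUnion₂.1 ((h1 i hi).2 hzC)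
        exact mem_biUnion hx (mem_biUnion hl ⟨hzx, hzl⟩)
      have hne : ∀ i ∈ s, i ≠ k := fun i hi h => hk (h ▸ hi)
      refine ⟨Function.update C k D, Function.update S k T, ?_, ?_⟩
      · intro i hi
        rcases Finset.mem_insert.1 hi with rfl | hi
        · simpa using ⟨hP, hDT⟩
        · simpa [hne i hi] using h1 i hi
      · intro i hi j hj hij
        rcases Finset.mem_insert.1 hi with rfl | his <;>
          rcases Finset.mem_insert.1 hj with rfl | hjs
        · exact absurd rfl hij
        · simpa [hne j hjs] using hD j hjs
        · simpa [hne i his, inter_comm] using hD i his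
        · simpa [hne i his, hne j hjs] using h2 i his j hjs hij
  obtain ⟨C, S, h1, h2⟩ := key Finset.univ
  exact ⟨C, fun i => (h1 i (Finset.mem_univ i)).1,
    fun i j => h2 i (Finset.mem_univ i) j (Finset.mem_univ j)⟩

/-! ### Redrawing arcs with finite intersections -/

/-- The arcs representing the edges of a finite graph can be redrawn with pairwise finite
intersections, so that edges that meet in vertices only still do so. -/
theorem exists_redrawing {V : Type*} [Finite V] (G : SimpleGraph V) (R : Sym2 V → Sym2 V → Prop)
    {pos : V → Plane} (hpos : Function.Injective pos) {A : Sym2 V → Set Plane}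
    (hA : ∀ u v, G.Adj u v → IsArcBetween (A s(u, v)) (pos u) (pos v))
    (hmem : ∀ e ∈ G.edgeSet, ∀ w, pos w ∈ A e → w ∈ e)
    (hR : ∀ e ∈ G.edgeSet, ∀ f ∈ G.edgeSet, e ≠ f → R e f → A e ∩ A f ⊆ range pos) :
    ∃ Γ : Drawing G, Γ.pos = pos ∧
      ∀ e ∈ G.edgeSet, ∀ f ∈ G.edgeSet, R e f → ¬ Γ.Cross e f := by
  classical
  obtain ⟨r, hr, hsep, hfar⟩ := exists_pos_vertex_radius hpos (E := G.edgeSet) (A := A) (by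
    intro e he
    induction e with
    | _ u v => exact (hA u v he).isCompact) hmem
  have hmid : ∀ e : G.edgeSet, ∃ (u v : V) (γ : ℝ → Plane) (s t : ℝ), e.1 = s(u, v) ∧ u ≠ v ∧
      Continuous γ ∧ s ≤ t ∧ γ '' Icc s t ⊆ A e ∧ dist (γ s) (pos u) = r ∧
      dist (γ t) (pos v) = r ∧ ∀ x ∈ γ '' Icc s t, ∀ w, r ≤ dist x (pos w) := by
    rintro ⟨e, he⟩
    induction e with
    | _ u v =>
      have huv : u ≠ v := G.ne_of_adj he
      obtain ⟨γ, s, t, hc, hst, hsub, hs, ht, hx⟩ :=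
        (hA u v he).exists_curve_between_spheres hr (by linarith [hsep u v huv])
      refine ⟨u, v, γ, s, t, rfl, huv, hc, hst, hsub, hs, ht, fun x hxm w => ?_⟩
      by_cases hw : w ∈ s(u, v)
      · rcases Sym2.mem_iff.1 hw with rfl | rfl
        · exact (hx x hxm).1
        · exact (hx x hxm).2
      · exact hfar _ he w hw x (hsub hxm)
  choose u v γ s t he huv hc hst hsub hs ht hout using hmid
  set M : G.edgeSet → Set Plane := fun e => γ e '' Icc (s e) (t e) with hMdef
  obtain ⟨δ, hδ, hdist⟩ := exists_pos_forall_le_dist (M := M)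
    (fun e => isCompact_Icc.image (hc e))
  -- The arcs meet in vertices only, and the middle pieces stay at distance `r` from every vertex.
  have hRd : ∀ e f : G.edgeSet, e ≠ f → R e f → ∀ x ∈ M e, ∀ y ∈ M f, δ ≤ dist x y := by
    intro e f hef hRef
    refine hdist e f (disjoint_left.2 fun x hx hx' => ?_)
    obtain ⟨w, rfl⟩ := hR e e.2 f f.2 (Subtype.coe_ne_coe.2 hef) hRef ⟨hsub e hx, hsub f hx'⟩
    have := hout e _ hx w
    rw [dist_self] at this
    linarith
  -- The tightest use against `δ` is a cone meeting a tube, which puts the middle pieces within `6 *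
  -- η`.
  obtain ⟨η, hη, hηr, hηδ⟩ : ∃ η > 0, 8 * η ≤ r ∧ 8 * η ≤ δ :=
    ⟨min r δ / 8, by positivity, by linarith [min_le_left r δ], by linarith [min_le_right r δ]⟩
  set Z : G.edgeSet → Set Plane := fun e =>
    segmentCone (pos (u e)) (γ e (s e)) η ∪ segmentCone (pos (v e)) (γ e (t e)) η ∪
      Metric.thickening (2 * η) (M e) with hZ
  have hZmem : ∀ e, ∀ z ∈ Z e, (∃ w ∈ e.1, ∃ y ∈ M e, dist y (pos w) = r ∧
      z ∈ segmentCone (pos w) y η) ∨ ∃ x ∈ M e, dist z x < 2 * η := by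
    rintro e z ((hz | hz) | hz)
    · exact Or.inl ⟨u e, by rw [he e]; simp, _, ⟨s e, ⟨le_rfl, hst e⟩, rfl⟩, hs e, hz⟩
    · exact Or.inl ⟨v e, by rw [he e]; simp, _, ⟨t e, ⟨hst e, le_rfl⟩, rfl⟩, ht e, hz⟩
    · exact Or.inr (Metric.mem_thickening_iff.1 hz)
  have hZpos : ∀ e, ∀ w, pos w ∈ Z e → w ∈ e.1 := by
    intro e w hw
    rcases hZmem e _ hw with ⟨w', hw', y, -, hyr, hz⟩ | ⟨x, hx, hlt⟩
    · by_contra hwe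
      have hne : w ≠ w' := fun h => hwe (h ▸ hw')
      linarith [hsep w w' hne, dist_lt_of_mem_segmentCone hyr hz]
    · have := hout e x hx w
      rw [dist_comm] at this
      linarith
  -- A point near `M f` is at least `r - 2 * η` from `w`, so in the cone it is close to the base
  -- point `y` of `M e`.
  have hmix : ∀ (e f : G.edgeSet), (∀ x ∈ M e, ∀ y ∈ M f, δ ≤ dist x y) → ∀ z w, ∀ y ∈ M e,
      dist y (pos w) = r → z ∈ segmentCone (pos w) y η → ∀ x ∈ M f, dist z x < 2 * η → False := by
    intro e f hef z w y hy hyr hz x hx hlt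
    have h1 := hout f x hx w
    have h2 := dist_triangle x z (pos w)
    rw [dist_comm x z] at h2
    have h3 := dist_lt_of_mem_segmentCone_of_lt (ε := 2 * η) hyr hz (by linarith)
    have h4 := hef y hy x hx
    have h5 := dist_triangle y z x
    rw [dist_comm y z] at h5
    linarith
  have hZZ : ∀ e f : G.edgeSet, e ≠ f → R e f → Z e ∩ Z f ⊆ range pos := by
    rintro e f hef hRef z ⟨hze, hzf⟩
    have hd := hRd e f hef hRef
    have hd' : ∀ x ∈ M f, ∀ y ∈ M e, δ ≤ dist x y := fun x hx y hy =>
      dist_comm x y ▸ hd y hy x hx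
    rcases hZmem e z hze with ⟨w, -, y, hy, hyr, hz⟩ | ⟨x, hx, hlt⟩ <;>
      rcases hZmem f z hzf with ⟨w', -, y', hy', hyr', hz'⟩ | ⟨x', hx', hlt'⟩
    · by_cases hww : w = w'
      · subst hww
        have hyy := hd y hy y' hy'
        exact ⟨w, (eq_of_mem_segmentCone hyr hyr' (by linarith) hz hz').symm⟩
      · have h1 := dist_lt_of_mem_segmentCone hyr hz
        have h2 := dist_lt_of_mem_segmentCone hyr' hz'
        have h3 := dist_triangle_left (pos w) (pos w') z
        linarith [hsep w w' hww]
    · exact (hmix e f hd z w y hy hyr hz x' hx' hlt').elim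
    · exact (hmix f e hd' z w' y' hy' hyr' hz' x hx hlt).elim
    · have := dist_triangle_left x x' z
      linarith [hd x hx x' hx']
  obtain ⟨C, hC, hfin⟩ := exists_pairwise_finite_inter
    (P := fun (e : G.edgeSet) C => IsArcBetween C (pos (u e)) (pos (v e)) ∧ C ⊆ Z e) (by
      intro e L
      obtain ⟨C, S, h1, h2, h3, h4⟩ :=
        exists_polygonal_arc L (hc e) (hst e) hη (hpos.ne (huv e))
      exact ⟨C, S, ⟨h1, h4⟩, h2, h3⟩)
  let A' : Sym2 V → Set Plane := fun e => if h : e ∈ G.edgeSet then C ⟨e, h⟩ else ∅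
  have hA' : ∀ e (h : e ∈ G.edgeSet), A' e = C ⟨e, h⟩ := fun e h => dif_pos h
  refine ⟨⟨pos, A', hpos, ?_, ?_, ?_⟩, rfl, ?_⟩
  · intro x y hxy
    have h1 := (hC ⟨s(x, y), hxy⟩).1
    have h2 : s(x, y) = s(_, _) := he ⟨s(x, y), hxy⟩
    rw [hA' _ hxy]
    rcases Sym2.eq_iff.1 h2 with ⟨hx, hy⟩ | ⟨hx, hy⟩
    · rwa [← hx, ← hy] at h1
    · rw [← hx, ← hy] at h1
      exact h1.symm
  · intro e hee w hw
    rw [hA' e hee] at hw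
    exact hZpos ⟨e, hee⟩ w ((hC _).2 hw)
  · intro e hee f hff hef
    rw [hA' e hee, hA' f hff]
    exact hfin _ _ (fun h => hef (congrArg Subtype.val h))
  · rintro e hee f hff hRef ⟨hef, p, ⟨hpe, hpf⟩, hp⟩
    change p ∈ A' e at hpe
    change p ∈ A' f at hpf
    rw [hA' e hee] at hpe
    rw [hA' f hff] at hpf
    exact hp (hZZ ⟨e, hee⟩ ⟨f, hff⟩ (fun h => hef (congrArg Subtype.val h)) hRef
      ⟨(hC _).2 hpe, (hC _).2 hpf⟩)

/-! ### Transport of drawings by homeomorphisms -/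

namespace Drawing

variable {V : Type*} {G H : SimpleGraph V}

/-- The image of a drawing under a homeomorphism of the plane. -/
def map (Γ : Drawing G) (φ : Plane ≃ₜ Plane) : Drawing G where
  pos v := φ (Γ.pos v)
  arc e := φ '' Γ.arc e
  pos_injective := φ.injective.comp Γ.pos_injective
  isArc u v huv := (Γ.isArc u v huv).image φ
  mem_of_pos_mem e he w hw := Γ.mem_of_pos_mem e he w ((φ.injective.mem_set_image).1 hw)
  finite_inter e he f hf hef := by
    rw [← image_inter φ.injective]
    exact (Γ.finite_inter e he f hf hef).image φ

theorem IsPlanar.map {Γ : Drawing G} (h : Γ.IsPlanar) (φ : Plane ≃ₜ Plane) :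
    (Γ.map φ).IsPlanar := by
  rintro e he f hf ⟨hef, _, ⟨⟨p, hp, rfl⟩, ⟨q, hq, hpq⟩⟩, hr⟩
  obtain rfl : q = p := φ.injective hpq
  refine h e he f hf ⟨hef, q, ⟨hp, hq⟩, ?_⟩
  rintro ⟨v, rfl⟩
  exact hr ⟨v, rfl⟩

/-- An extendable planar embedding is extended by a drawing that agrees with it on the nose. -/
theorem ExtendsTo.exists_eq {Δ : Drawing H} {h : H ≤ G} (hΔ : Δ.ExtendsTo h) :
    ∃ Γ : Drawing G, Γ.IsPlanar ∧ Γ.pos = Δ.pos ∧ ∀ e ∈ H.edgeSet, Γ.arc e = Δ.arc e := by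
  obtain ⟨Γ, hΓ, φ, hv, he⟩ := hΔ
  exact ⟨Γ.map φ, hΓ.map φ, funext hv, he⟩

end Drawing

/-! ### Distributing the edges among three drawings -/

/-- Three planar drawings that agree on the common edges yield a QuaSEFE. -/
theorem admitsQuaSEFE_of_common_drawing {V : Type*} [Finite V] (G : Fin 3 → SimpleGraph V)
    (pos : V → Plane) (B : ∀ i, Drawing (G i)) (hB : ∀ i, (B i).IsPlanar)
    (hpos : ∀ i, (B i).pos = pos)
    (harc : ∀ e, (∀ i, e ∈ (G i).edgeSet) → ∀ i j, (B i).arc e = (B j).arc e) :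
    AdmitsQuaSEFE G := by
  classical
  -- `D i e` says that `e` is to be drawn as in the drawing `B i`
  let D : Fin 3 → Sym2 V → Prop := fun i e =>
    e ∈ (G i).edgeSet ∧ ((∀ j, e ∈ (G j).edgeSet) ∨ e ∉ (G (i + 2)).edgeSet)
  -- Modulo 3, `i + 2` is the predecessor of `i`; an edge of exactly these two graphs is drawn as in
  -- the predecessor's drawing.
  have hcover : ∀ i, ∀ e ∈ (G i).edgeSet, D i e ∨ D (i + 2) e := by
    intro i e he
    by_cases h2 : e ∈ (G (i + 2)).edgeSet
    · by_cases h1 : e ∈ (G (i + 2 + 2)).edgeSet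
      · refine Or.inl ⟨he, Or.inl fun j => ?_⟩
        fin_cases i <;> fin_cases j <;> assumption
      · exact Or.inr ⟨h2, Or.inr h1⟩
    · exact Or.inl ⟨he, Or.inr h2⟩
  have huniq : ∀ i j e, D i e → D j e → (B i).arc e = (B j).arc e := by
    rintro i j e ⟨hi, hi' | hi'⟩ ⟨hj, hj' | hj'⟩
    · exact harc e hi' i j
    · exact harc e hi' i j
    · exact harc e hj' i j
    -- Of two distinct indices modulo 3, one precedes the other, so the edge would both lie and not
    -- lie in the preceding graph.
    · have : i = j := by
        fin_cases i <;> fin_cases j <;> first | rfl | contradiction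
      rw [this]
  let A : Sym2 V → Set Plane := fun e => if h : ∃ i, D i e then (B h.choose).arc e else ∅
  have hA : ∀ i e, D i e → A e = (B i).arc e := by
    intro i e hi
    have h : ∃ i, D i e := ⟨i, hi⟩
    exact (dif_pos h).trans (huniq _ _ _ h.choose_spec hi)
  let U : SimpleGraph V := ⨆ i, G i
  have hU : ∀ i, G i ≤ U := le_iSup G
  have hUD : ∀ e ∈ U.edgeSet, ∃ i, D i e := by
    intro e he
    obtain ⟨i, hi⟩ : ∃ i, e ∈ (G i).edgeSet := by
      induction e with
      | _ u v => exact SimpleGraph.iSup_adj.1 he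
    exact (hcover i e hi).elim (fun h => ⟨_, h⟩) fun h => ⟨_, h⟩
  -- Redrawing the union at once gives each shared edge a single curve.
  obtain ⟨Γ, -, hcross⟩ := exists_redrawing U (fun e f => ∃ i, D i e ∧ D i f) (pos := pos)
    (hpos 0 ▸ (B 0).pos_injective) (A := A)
    (by
      intro u v huv
      obtain ⟨i, hi⟩ := hUD s(u, v) huv
      rw [hA i _ hi, ← hpos i]
      exact (B i).isArc u v hi.1)
    (by
      intro e he w hw
      obtain ⟨i, hi⟩ := hUD e he
      rw [hA i _ hi, ← hpos i] at hw
      exact (B i).mem_of_pos_mem e hi.1 w hw)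
    (by
      rintro e - f - hef ⟨i, hie, hif⟩ p hp
      rw [hA i _ hie, hA i _ hif] at hp
      by_contra h
      exact hB i e hie.1 f hif.1 ⟨hef, p, hp, by rwa [hpos i]⟩)
  refine ⟨fun i => Γ.restrict (hU i), fun i e he f hf g hg => ?_, fun _ _ _ => rfl,
    fun _ _ _ _ => rfl⟩
  have hno : ∀ e ∈ (G i).edgeSet, ∀ f ∈ (G i).edgeSet, (Γ.restrict (hU i)).Cross e f →
      ∀ j, D j e → D j f → False := fun e he f hf hef j hj hj' =>
    hcross e (SimpleGraph.edgeSet_mono (hU i) he) f (SimpleGraph.edgeSet_mono (hU i) hf)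
      ⟨j, hj, hj'⟩ hef
  rintro ⟨hef, hfg, heg⟩
  have h1 := hno e he f hf hef
  have h2 := hno f hf g hg hfg
  have h3 := hno e he g hg heg
  -- Pigeonhole: three edges, two source drawings.
  rcases hcover i e he with a | a <;> rcases hcover i f hf with b | b <;>
    rcases hcover i g hg with c | c <;>
    first | exact h1 _ a b | exact h2 _ b c | exact h3 _ a c

theorem theorem4 {V : Type*} [Finite V] (G₁ G₂ G₃ : SimpleGraph V)
    (h₁ : IsPlanarGraph G₁) (h₂ : IsPlanarGraph G₂) (h₃ : IsPlanarGraph G₃)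
    (H : SimpleGraph V) (hH : H = G₁ ⊓ G₂ ⊓ G₃)
    (hH₁ : H ≤ G₁) (hH₂ : H ≤ G₂) (hH₃ : H ≤ G₃)
    (hext : ∃ Δ : Drawing H, Δ.IsPlanar ∧
      Δ.ExtendsTo hH₁ ∧ Δ.ExtendsTo hH₂ ∧ Δ.ExtendsTo hH₃) :
    AdmitsQuaSEFE ![G₁, G₂, G₃] := by
  obtain ⟨Δ, -, hΔ₁, hΔ₂, hΔ₃⟩ := hext
  obtain ⟨Γ₁, hp₁, hv₁, ha₁⟩ := hΔ₁.exists_eq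
  obtain ⟨Γ₂, hp₂, hv₂, ha₂⟩ := hΔ₂.exists_eq
  obtain ⟨Γ₃, hp₃, hv₃, ha₃⟩ := hΔ₃.exists_eq
  have hB : ∀ i, ∃ Γ : Drawing (![G₁, G₂, G₃] i), Γ.IsPlanar ∧ Γ.pos = Δ.pos ∧
      ∀ e ∈ H.edgeSet, Γ.arc e = Δ.arc e := by
    intro i
    fin_cases i
    · exact ⟨Γ₁, hp₁, hv₁, ha₁⟩
    · exact ⟨Γ₂, hp₂, hv₂, ha₂⟩
    · exact ⟨Γ₃, hp₃, hv₃, ha₃⟩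
  choose B hBp hBv hBa using hB
  refine admitsQuaSEFE_of_common_drawing _ Δ.pos B hBp hBv fun e he i j => ?_
  have heH : e ∈ H.edgeSet := by
    rw [hH, SimpleGraph.edgeSet_inf, SimpleGraph.edgeSet_inf]
    exact ⟨⟨he 0, he 1⟩, he 2⟩
  rw [hBa i e heH, hBa j e heH]
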